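/- Let $d\ge 1$, and let $\alpha\in\mathbb R^d$ have at least one irrational component. Let $\overline{\mathbb R}=\mathbb R\cup\{\infty\}$ be the one-point compactification of $\mathbb R$ (a circle), and let $f\colon\mathbb R\to[-\infty,+\infty)$ be $1$-periodic. Identify $[0,1)$ with the circle $\mathbb R/\mathbb Z$ and $[-\infty,+\infty)$ with the circle $\overline{\mathbb R}$ (with $-\infty$ corresponding to $\infty$), and suppose that the resulting circle map $\mathbb R/\mathbb Z\to\overline{\mathbb R}$ defined by $f|_{[0,1)}$ is continuous and not homotopic to a constant map. For $x\in\mathbb R$ put $V_x(n)=f(x+n\cdot\alpha)\in\overline{\mathbb R}$ for $n\in\mathbb Z^d$ and $I_x=\{n\in\mathbb Z^d : V_x(n)=\infty\}$, and let $H(x)$ be the quasiperiodic operator $$(H(x)\psi)(n)=\mathbf 1_{\mathbb Z^d\setminus I_x}(n)\,(\Delta\psi)(n)+V_x(n)\psi(n),\qquad (\Delta\psi)(n)=\sum_{|m-n|_1=1}\psi(m),$$ with domain $\{\psi\in\ell^2(\mathbb Z^d):\sum_n|V_x(n)\psi(n)|^2<\infty\}$, where $\infty\cdot 0=0$ (so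 that $\psi=0$ on $I_x$). Regard $H(x)$ as an operator in $\ell^2(\mathbb Z^d\setminus I_x)$, the closure of its domain. Then, for every $x\in\mathbb R$, $\sigma(H(x))=\mathbb R$. -/

import Mathlib

open scoped OnePoint

noncomputable section

/-- The square-summable complex functions on the lattice `ℤ^d`. -/
abbrev L2 (d : ℕ) : Type := lp (fun _ : Fin d → ℤ => ℂ) 2

/-- The identification of `[-∞, +∞)` with the circle `ℝ ∪ {∞}` (the one-point compactification
of `ℝ`), sending `-∞` to `∞`. -/
def toRbar : WithBot ℝ → OnePoint ℝ :=
  WithBot.recBotCoe ∞ (fun r => (r : OnePoint ℝ))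

/-- The circle map associated to `f` restricted to `[0, 1)`: the interval `[0, 1)` is identified
with the circle `ℝ / ℤ` and `[-∞, +∞)` with the circle `ℝ ∪ {∞}`. -/
def circleMap01 (f : ℝ → WithBot ℝ) : UnitAddCircle → OnePoint ℝ :=
  AddCircle.liftIco 1 0 (fun x => toRbar (f x))

/-- The value of a point of `ℝ ∪ {∞}`, with `0` in place of `∞`. It only multiplies values that
vanish wherever the point is `∞`, so this implements the convention `∞ * 0 = 0`. -/
def finitePart : OnePoint ℝ → ℝ :=
  fun t => t.elim 0 (fun r => r)

/-- The discrete Laplacian, i.e. the sum over the `2 d` nearest neighbours in `ℤ^d`. -/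
def latticeLaplacian {d : ℕ} (ψ : (Fin d → ℤ) → ℂ) (n : Fin d → ℤ) : ℂ :=
  ∑ i : Fin d, (ψ (n + Pi.single i 1) + ψ (n - Pi.single i 1))

theorem memlp_shift {d : ℕ} {ψ : (Fin d → ℤ) → ℂ} (hψ : Memℓp ψ 2) (m : Fin d → ℤ) :
    Memℓp (fun n => ψ (n + m)) 2 := by
  have h2 : 0 < (2 : ENNReal).toReal := by norm_num
  rw [memℓp_gen_iff h2] at hψ ⊢
  exact (Equiv.addRight m).summable_iff.mpr hψ

theorem memlp_laplacian {d : ℕ} {ψ : (Fin d → ℤ) → ℂ} (hψ : Memℓp ψ 2) :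
    Memℓp (latticeLaplacian ψ) 2 := by
  have h : Memℓp (fun n => ∑ i ∈ (Finset.univ : Finset (Fin d)),
      (fun (i : Fin d) (n : Fin d → ℤ) =>
        ψ (n + Pi.single i 1) + ψ (n - Pi.single i 1)) i n) 2 := by
    refine Memℓp.finsetSum Finset.univ fun i _ => ?_
    have h1 := memlp_shift hψ (Pi.single i 1)
    have h2 := memlp_shift hψ (-Pi.single i 1)
    have h3 := h1.add h2
    refine (congrArg (fun g : (Fin d → ℤ) → ℂ => Memℓp g 2) ?_).mp h3
    funext n
    simp [sub_eq_add_neg]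
  exact h

theorem memlp_indicator {d : ℕ} {ψ : (Fin d → ℤ) → ℂ} (hψ : Memℓp ψ 2)
    (s : Set (Fin d → ℤ)) : Memℓp (s.indicator ψ) 2 := by
  have h2 : 0 < (2 : ENNReal).toReal := by norm_num
  rw [memℓp_gen_iff h2] at hψ ⊢
  refine Summable.of_nonneg_of_le (fun n => by positivity) (fun n => ?_) hψ
  gcongr
  exact norm_indicator_le_norm_self ψ n

/-- The domain of the Schrödinger operator with potential `V : ℤ^d → ℝ ∪ {∞}`: the
`ψ ∈ ℓ²(ℤ^d)` with `∑ |V(n) ψ(n)|² < ∞`, where `∞ * 0 = 0`. In particular `ψ` has to vanish at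
every point where `V` is infinite. -/
def schrodingerDomain {d : ℕ} (V : (Fin d → ℤ) → OnePoint ℝ) : Submodule ℂ (L2 d) where
  carrier := {ψ | (∀ n, V n = ∞ → ψ n = 0) ∧
    Memℓp (fun n => (finitePart (V n) : ℂ) * ψ n) 2}
  zero_mem' := by
    refine ⟨fun _ _ => rfl, ?_⟩
    refine (congrArg (fun g : (Fin d → ℤ) → ℂ => Memℓp g 2) ?_).mp zero_memℓp
    funext n
    simp
  add_mem' := by
    rintro ψ φ ⟨h1, h2⟩ ⟨h3, h4⟩
    refine ⟨fun n hn => by simp [h1 n hn, h3 n hn], ?_⟩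
    have h := h2.add h4
    refine (congrArg (fun g : (Fin d → ℤ) → ℂ => Memℓp g 2) ?_).mp h
    funext n
    simp [mul_add]
  smul_mem' := by
    rintro c ψ ⟨h1, h2⟩
    refine ⟨fun n hn => by simp [h1 n hn], ?_⟩
    have h := h2.const_smul c
    refine (congrArg (fun g : (Fin d → ℤ) → ℂ => Memℓp g 2) ?_).mp h
    funext n
    simp [mul_left_comm]

/-- The expression `(H ψ)(n) = 1_{V(n) ≠ ∞} (Δ ψ)(n) + V(n) ψ(n)`. -/
def schrodingerExpr {d : ℕ} (V : (Fin d → ℤ) → OnePoint ℝ) (ψ : (Fin d → ℤ) → ℂ)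
    (n : Fin d → ℤ) : ℂ :=
  {m | V m ≠ ∞}.indicator (latticeLaplacian ψ) n + (finitePart (V n) : ℂ) * ψ n

/-- The discrete Schrödinger operator with potential `V : ℤ^d → ℝ ∪ {∞}`, as an unbounded operator
in `ℓ²(ℤ^d)`. -/
def schrodinger {d : ℕ} (V : (Fin d → ℤ) → OnePoint ℝ) : L2 d →ₗ.[ℂ] L2 d where
  domain := schrodingerDomain V
  toFun :=
    { toFun := fun ψ =>
        ⟨schrodingerExpr V (ψ : L2 d),
          (memlp_indicator (memlp_laplacian (lp.memℓp (ψ : L2 d))) _).add ψ.2.2⟩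
      map_add' := by
        intro ψ φ
        ext n
        change schrodingerExpr V (fun m => (ψ : L2 d) m + (φ : L2 d) m) n
          = schrodingerExpr V (ψ : L2 d) n + schrodingerExpr V (φ : L2 d) n
        by_cases h : V n = ∞
        · simp [schrodingerExpr, Set.indicator, h, mul_add]
        · simp [schrodingerExpr, Set.indicator, h, latticeLaplacian, Finset.sum_add_distrib]
          ring
      map_smul' := by
        intro c ψ
        ext n
        change schrodingerExpr V (fun m => c * (ψ : L2 d) m) n
          = c * schrodingerExpr V (ψ : L2 d) n
        by_cases h : V n = ∞
        · simp [schrodingerExpr, Set.indicator, h, mul_left_comm]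
        · simp [schrodingerExpr, Set.indicator, h, latticeLaplacian, Finset.mul_sum,
            Finset.sum_add_distrib, mul_add, mul_left_comm] }

/-- The resolvent set of an unbounded operator `T`, regarded as an operator in the closed subspace
`K` that is the closure of its domain: the `z` for which `T - z` maps the domain bijectively onto
`K` with bounded inverse. For densely defined `T`, `K` is the whole space and this is the usual
notion. -/
def unboundedResolventSet {E : Type*} [NormedAddCommGroup E] [NormedSpace ℂ E]
    (T : E →ₗ.[ℂ] E) : Set ℂ :=
  {z | Set.BijOn (fun ψ : T.domain => T ψ - z • (ψ : E)) Set.univ (closure (T.domain : Set E)) ∧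
    ∃ C : ℝ, ∀ ψ : T.domain, ‖(ψ : E)‖ ≤ C * ‖T ψ - z • (ψ : E)‖}

/-- The spectrum of an unbounded operator, regarded as an operator in the closure of its domain. -/
def unboundedSpectrum {E : Type*} [NormedAddCommGroup E] [NormedSpace ℂ E]
    (T : E →ₗ.[ℂ] E) : Set ℂ :=
  (unboundedResolventSet T)ᶜ

/-- The potential `n ↦ f (x + n · α)` on `ℤ^d`, with `-∞` identified with `∞`. -/
def quasiperiodicPotential {d : ℕ} (f : ℝ → WithBot ℝ) (α : Fin d → ℝ) (x : ℝ) :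
    (Fin d → ℤ) → OnePoint ℝ :=
  fun n => toRbar (f (x + ∑ i, (n i : ℝ) * α i))

/-- The quasiperiodic operator `(H(x) ψ)(n) = (Δ ψ)(n) + f (x + n · α) ψ(n)`. -/
def quasiperiodicOperator {d : ℕ} (f : ℝ → WithBot ℝ) (α : Fin d → ℝ) (x : ℝ) :
    L2 d →ₗ.[ℂ] L2 d :=
  schrodinger (quasiperiodicPotential f α x)

end

/-!
The spectrum is real because the operator is self-adjoint in the closure of its domain. That every
real `E` belongs to it is a spectral flow argument, combined with the density of the orbit
`x + n · α` in the circle.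

Everything is written in terms of `g = 1 / (V + i)` (`resolventValue`), which is continuous on
`ℝ ∪ {∞}` and vanishes at `∞`. A vector `ψ = g χ` is in the domain for every `χ ∈ ℓ²`, and
`(H - z) ψ = (Δ - z) (g χ) + (1 - i g) χ` wherever `V` is finite. The right-hand side
(`latticePencil`) depends continuously on `V` as a map into the circle, so the infinities of the
potential cause no trouble.

*Rational frequencies* (`exists_mulVec_pencil_eq_zero`, `exists_bounded_latticePencil_eq_zero`).
When `α` is replaced by `p / N`, the operator acts on functions on the torus `(ℤ / N)^d`. The
determinant of the finite pencil is a continuous function of the base point `y` in the circle, and it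
has no zeros for nonreal `z`. If it had none for `z = E` either, then moving `z` from `-i` to `i`
through `E` (with `Δ` switched off at both ends) would deform the constant `1` into the product of
the Cayley transforms `1 - 2 i g` over the torus without zeros. That product would then have a
continuous logarithm, hence so would a power of the Cayley transform of `f`, and `f` would be
homotopic to a constant. So for some `y` there is a periodic solution `φ` of the eigenvalue equation,
which can be translated so that `|φ| ≤ 1 = |φ 0|`.

*Passage to `α`* (`ofReal_notMem_unboundedResolventSet`). The damped function
`χ n = exp (-κ |n|₁) φ n` solves the equation up to an error of order `κ ‖χ‖`
(`norm_pencilL2_damped_le`), uniformly in `N`. As `N → ∞`, the rational potential is close on bounded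
sets to a translate of the potential `f (x + n · α)`, by the density of the orbit, and dominated
convergence makes the difference negligible on damped functions. If `E` were in the resolvent set,
the pencil would be bounded below by a constant that is the same for all translates
(`norm_le_of_resolvent_bound`, `norm_pencilL2_translate`), a contradiction.
-/

open scoped OnePoint
noncomputable section

open Complex Filter Topology Set ComplexConjugate

/-! ### The Cayley parametrization of the circle `ℝ ∪ {∞}` -/

/-- The function `v ↦ 1 / (v + i)` on `ℝ ∪ {∞}`, with the value `0` at `∞`. -/
def resolventValue (t : OnePoint ℝ) : ℂ :=
  t.elim 0 (fun v => ((v : ℂ) + I)⁻¹)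

@[simp] theorem resolventValue_infty : resolventValue ∞ = 0 := rfl

@[simp] theorem resolventValue_coe (v : ℝ) :
    resolventValue (v : OnePoint ℝ) = ((v : ℂ) + I)⁻¹ := rfl

@[simp] theorem finitePart_coe (v : ℝ) : finitePart (v : OnePoint ℝ) = v := rfl

theorem ofReal_add_I_ne_zero (v : ℝ) : (v : ℂ) + I ≠ 0 := by
  intro h
  have := congrArg Complex.im h
  simp at this

theorem continuous_resolventValue : Continuous resolventValue := by
  rw [OnePoint.continuous_iff]
  refine ⟨?_, ?_⟩
  · simp only [resolventValue_infty, resolventValue_coe]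
    refine tendsto_inv₀_cobounded.comp ?_
    rw [coclosedCompact_eq_cocompact, ← Metric.cobounded_eq_cocompact,
      ← tendsto_norm_atTop_iff_cobounded]
    refine tendsto_atTop_mono (fun v => ?_) tendsto_norm_cobounded_atTop
    simpa using Complex.abs_re_le_norm ((v : ℂ) + I)
  · simp only [resolventValue_coe]
    exact (continuous_ofReal.add continuous_const).inv₀ ofReal_add_I_ne_zero

theorem norm_resolventValue_le_one (t : OnePoint ℝ) : ‖resolventValue t‖ ≤ 1 := by
  induction t using OnePoint.rec with
  | infty => simp
  | coe v =>
    rw [resolventValue_coe, norm_inv]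
    refine inv_le_one_of_one_le₀ ?_
    have := Complex.abs_im_le_norm ((v : ℂ) + I)
    simpa using this

theorem resolventValue_coe_ne_zero (v : ℝ) : resolventValue (v : OnePoint ℝ) ≠ 0 :=
  inv_ne_zero (ofReal_add_I_ne_zero v)

theorem finitePart_mul_resolventValue_of_ne {t : OnePoint ℝ} (ht : t ≠ ∞) :
    (finitePart t : ℂ) * resolventValue t = 1 - I * resolventValue t := by
  induction t using OnePoint.rec with
  | infty => exact absurd rfl ht
  | coe v =>
    have := ofReal_add_I_ne_zero v
    simp only [finitePart_coe, resolventValue_coe]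
    field_simp
    ring

theorem conj_resolventValue_mul_im (t : OnePoint ℝ) :
    (conj (resolventValue t) * (1 - I * resolventValue t)).im = 0 := by
  induction t using OnePoint.rec with
  | infty => simp
  | coe v =>
    rw [← finitePart_mul_resolventValue_of_ne (OnePoint.coe_ne_infty v), mul_left_comm,
      ← Complex.normSq_eq_conj_mul_self, finitePart_coe, ← Complex.ofReal_mul, Complex.ofReal_im]

theorem cayley_coe (v : ℝ) :
    1 - 2 * I * resolventValue (v : OnePoint ℝ) = ((v : ℂ) - I) / ((v : ℂ) + I) := by
  have := ofReal_add_I_ne_zero v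
  rw [resolventValue_coe]
  field_simp
  ring

theorem norm_cayley (t : OnePoint ℝ) : ‖1 - 2 * I * resolventValue t‖ = 1 := by
  induction t using OnePoint.rec with
  | infty => simp
  | coe v =>
    rw [cayley_coe, norm_div, div_eq_one_iff_eq (norm_ne_zero_iff.2 (ofReal_add_I_ne_zero v))]
    have : (v : ℂ) - I = conj ((v : ℂ) + I) := by simp [sub_eq_add_neg]
    rw [this, Complex.norm_conj]

/-- The Cayley transform `v ↦ (v - i) / (v + i)` from `ℝ ∪ {∞}` to the unit circle. -/
def cayley (t : OnePoint ℝ) : Circle :=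
  ⟨1 - 2 * I * resolventValue t, mem_sphere_zero_iff_norm.2 (norm_cayley t)⟩

theorem coe_cayley (t : OnePoint ℝ) : (cayley t : ℂ) = 1 - 2 * I * resolventValue t := rfl

theorem continuous_cayley : Continuous cayley :=
  (continuous_const.sub (continuous_const.mul continuous_resolventValue)).subtype_mk _

theorem resolventValue_injective : Function.Injective resolventValue := by
  intro s t h
  induction s using OnePoint.rec with
  | infty =>
    induction t using OnePoint.rec with
    | infty => rfl
    | coe v => exact absurd h.symm (resolventValue_coe_ne_zero v)
  | coe w =>
    induction t using OnePoint.rec with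
    | infty => exact absurd h (resolventValue_coe_ne_zero w)
    | coe v =>
      have := inv_injective h
      rw [add_left_inj, Complex.ofReal_inj] at this
      rw [this]

theorem cayley_bijective : Function.Bijective cayley := by
  constructor
  · intro s t h
    apply resolventValue_injective
    have h' := congrArg (fun z : Circle => (z : ℂ)) h
    simp only [coe_cayley, sub_right_inj] at h'
    exact mul_left_cancel₀ (mul_ne_zero two_ne_zero I_ne_zero) h'
  · intro z
    by_cases hz : (z : ℂ) = 1
    · exact ⟨∞, Circle.ext (by simp [coe_cayley, hz])⟩
    · have h1 : 1 - (z : ℂ) ≠ 0 := sub_ne_zero.2 (Ne.symm hz)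
      -- the preimage of `z` is `i (1 + z) / (1 - z)`, which is real because `conj z = 1 / z`
      set w : ℂ := I * (1 + z) / (1 - z) with hw
      have hre : ((w.re : ℝ) : ℂ) = w := by
        rw [← Complex.conj_eq_iff_re, hw]
        have h0 : (z : ℂ) ≠ 0 := Circle.coe_ne_zero z
        have hc : conj (z : ℂ) = (z : ℂ)⁻¹ := by
          rw [← Circle.coe_inv_eq_conj, Circle.coe_inv]
        have h2 : (1 : ℂ) - (z : ℂ)⁻¹ ≠ 0 := by
          rw [sub_ne_zero]
          intro h
          exact hz (by rw [← inv_inv (z : ℂ), ← h, inv_one])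
        simp only [map_div₀, map_mul, map_add, map_sub, map_one, hc, conj_I]
        rw [div_eq_div_iff h2 h1]
        field_simp
        ring
      refine ⟨(w.re : ℝ), Circle.ext ?_⟩
      rw [coe_cayley, cayley_coe, div_eq_iff (ofReal_add_I_ne_zero _), hre, hw]
      field_simp
      ring

/-- The Cayley transform as a homeomorphism. -/
def cayleyHomeo : OnePoint ℝ ≃ₜ Circle :=
  (isHomeomorph_iff_continuous_bijective.2 ⟨continuous_cayley, cayley_bijective⟩).homeomorph

/-! ### Continuous logarithms -/

/-- Homotopy lifting along `exp`: a map to `ℂ \ {0}` homotopic in `ℂ \ {0}` to one with a continuous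
logarithm has a continuous logarithm. -/
theorem exists_log_of_homotopy {X : Type*} [TopologicalSpace X] (H : C(unitInterval × X, ℂ))
    (hH : ∀ p, H p ≠ 0) (l : C(X, ℂ)) (h0 : ∀ x, H (0, x) = exp (l x)) :
    ∃ h : C(X, ℂ), ∀ x, H (1, x) = exp (h x) := by
  let H' : C(unitInterval × X, {z : ℂ // z ≠ 0}) :=
    ⟨fun p => ⟨H p, hH p⟩, H.continuous.subtype_mk _⟩
  let L := Complex.isCoveringMap_exp.liftHomotopy H' l (fun a => Subtype.ext (h0 a))
  refine ⟨L.comp ⟨fun x => ((1 : unitInterval), x), by fun_prop⟩, fun x => ?_⟩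
  have h := congrFun (Complex.isCoveringMap_exp.liftHomotopy_lifts H' l
    (fun a => Subtype.ext (h0 a))) (1, x)
  exact (congrArg Subtype.val h).symm

/-- A map to the circle `ℝ ∪ {∞}` is homotopic to a constant if some positive power of its Cayley
transform has a continuous logarithm: up to a root of unity, which is locally constant, the
logarithm can be divided by the exponent. -/
theorem nullhomotopic_of_cayley_pow_eq_exp {X : Type*} [TopologicalSpace X] [ConnectedSpace X]
    (F : C(X, OnePoint ℝ)) {K : ℕ} (hK : K ≠ 0) (h : C(X, ℂ))
    (hh : ∀ x, (1 - 2 * I * resolventValue (F x)) ^ K = exp (h x)) : F.Nullhomotopic := by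
  let θ : C(X, ℝ) := ⟨fun x => (h x).im / K, by fun_prop⟩
  have hre : ∀ x, h x = K * (θ x * I) := by
    intro x
    have h1 : ‖exp (h x)‖ = 1 := by rw [← hh, norm_pow, norm_cayley, one_pow]
    rw [Complex.norm_exp, Real.exp_eq_one_iff] at h1
    have hK' : (K : ℝ) ≠ 0 := Nat.cast_ne_zero.2 hK
    apply Complex.ext
    · simp [h1]
    · simp [θ]
      field_simp
  let q : X → ℂ := fun x => (1 - 2 * I * resolventValue (F x)) * exp (-(θ x * I))
  have hq : Continuous q := by
    have := continuous_resolventValue.comp F.continuous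
    have h2 := θ.continuous
    simp only [q]
    exact (continuous_const.sub (continuous_const.mul this)).mul (by fun_prop)
  have hqK : ∀ x, q x ^ K = 1 := by
    intro x
    simp only [q]
    rw [mul_pow, hh, ← Complex.exp_nat_mul, ← Complex.exp_add, hre]
    simp
  have hfin : {z : ℂ | z ^ K = 1}.Finite := by
    refine (Polynomial.nthRootsFinset K (1 : ℂ)).finite_toSet.subset fun z hz => ?_
    exact (Polynomial.mem_nthRootsFinset (Nat.pos_of_ne_zero hK) _).2 hz
  obtain ⟨x0⟩ : Nonempty X := inferInstance
  have hconst : ∀ x, q x = q x0 := by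
    intro x
    exact isPreconnected_univ.constant_of_mapsTo hfin.isDiscrete hq.continuousOn
      (fun y _ => hqK y) (mem_univ x) (mem_univ x0)
  have hF : F = ((cayleyHomeo.symm : C(Circle, OnePoint ℝ)).comp
      ⟨fun t : ℝ => cayley (F x0) * Circle.exp (t - θ x0), by fun_prop⟩).comp θ := by
    ext x
    rw [ContinuousMap.comp_apply, ContinuousMap.comp_apply]
    refine (cayleyHomeo.symm_apply_eq.2 ?_).symm
    refine Circle.ext ?_
    have h3 := hconst x
    simp only [q] at h3
    change (cayley (F x0) * Circle.exp (θ x - θ x0) : Circle) = (cayley (F x) : ℂ)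
    rw [Circle.coe_mul, Circle.coe_exp, coe_cayley, coe_cayley]
    rw [Complex.exp_neg, Complex.exp_neg, ← div_eq_mul_inv, ← div_eq_mul_inv,
      div_eq_div_iff (exp_ne_zero _) (exp_ne_zero _)] at h3
    push_cast
    rw [sub_mul (θ x : ℂ), Complex.exp_sub, mul_div_assoc', div_eq_iff (exp_ne_zero _), h3]
  rw [hF]
  have := (id_nullhomotopic ℝ).comp_right
    ((cayleyHomeo.symm : C(Circle, OnePoint ℝ)).comp
      ⟨fun t : ℝ => cayley (F x0) * Circle.exp (t - θ x0), by fun_prop⟩)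
  exact (this.comp_left θ)

/-! ### Spectral flow for finite Hermitian matrices -/

/-- The matrix `(A - z) D + (1 - i D)` with `D = diag g`. When `g = 1 / (v + i)`, it is the product
of `A + diag v - z` with `diag g`. -/
def pencil {ι : Type*} [Fintype ι] [DecidableEq ι] (A : Matrix ι ι ℂ) (z : ℂ) (g : ι → ℂ) :
    Matrix ι ι ℂ :=
  (A - z • 1) * Matrix.diagonal g + (1 - I • Matrix.diagonal g)

theorem pencil_mulVec {ι : Type*} [Fintype ι] [DecidableEq ι] (A : Matrix ι ι ℂ) (z : ℂ)
    (g φ : ι → ℂ) (n : ι) :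
    (pencil A z g).mulVec φ n
      = A.mulVec (fun m => g m * φ m) n - z * (g n * φ n) + (1 - I * g n) * φ n := by
  have hd : (Matrix.diagonal g).mulVec φ = fun m => g m * φ m := by
    funext m
    rw [Matrix.mulVec_diagonal]
  rw [pencil, Matrix.add_mulVec, ← Matrix.mulVec_mulVec, Matrix.sub_mulVec, Matrix.sub_mulVec,
    Matrix.smul_mulVec, Matrix.smul_mulVec, Matrix.one_mulVec, Matrix.one_mulVec, hd]
  simp
  ring

/-- Off the real axis the pencil is invertible, because `A + diag v` is Hermitian. -/
theorem det_pencil_ne_zero {ι : Type*} [Fintype ι] [DecidableEq ι] {A : Matrix ι ι ℂ}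
    (hA : A.IsHermitian) {z : ℂ} (hz : z.im ≠ 0) (v : ι → OnePoint ℝ) :
    (pencil A z fun n => resolventValue (v n)).det ≠ 0 := by
  intro hdet
  obtain ⟨φ, hφ, h0⟩ := Matrix.exists_mulVec_eq_zero_iff.2 hdet
  set g : ι → ℂ := fun n => resolventValue (v n) with hg
  set ψ : ι → ℂ := fun m => g m * φ m with hψ
  have hn : ∀ n, A.mulVec ψ n - z * ψ n + (1 - I * g n) * φ n = 0 := by
    intro n
    rw [← pencil_mulVec, h0, Pi.zero_apply]
  have hsum : star ψ ⬝ᵥ A.mulVec ψ - z * ∑ n, (normSq (ψ n) : ℂ)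
      + ∑ n, conj (ψ n) * ((1 - I * g n) * φ n) = 0 := by
    rw [dotProduct, Finset.mul_sum, ← Finset.sum_sub_distrib, ← Finset.sum_add_distrib]
    refine Finset.sum_eq_zero fun n _ => ?_
    rw [Complex.normSq_eq_conj_mul_self, Pi.star_apply, RCLike.star_def]
    linear_combination conj (ψ n) * hn n
  have him := congrArg Complex.im hsum
  have h1 : (star ψ ⬝ᵥ A.mulVec ψ).im = 0 := hA.im_star_dotProduct_mulVec_self ψ
  have h2 : (∑ n, conj (ψ n) * ((1 - I * g n) * φ n)).im = 0 := by
    rw [Complex.im_sum]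
    refine Finset.sum_eq_zero fun n _ => ?_
    have : conj (ψ n) * ((1 - I * g n) * φ n)
        = (normSq (φ n) : ℂ) * (conj (g n) * (1 - I * g n)) := by
      rw [Complex.normSq_eq_conj_mul_self, hψ]
      simp only [map_mul]
      ring
    rw [this, Complex.im_ofReal_mul, conj_resolventValue_mul_im, mul_zero]
  rw [Complex.add_im, Complex.sub_im, h1, h2, ← Complex.ofReal_sum, Complex.im_mul_ofReal] at him
  have h3 : ∑ n, normSq (ψ n) = 0 := by
    have : z.im * ∑ n, normSq (ψ n) = 0 := by simpa using him
    exact (mul_eq_zero.1 this).resolve_left hz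
  have h4 : ψ = 0 := by
    funext n
    exact normSq_eq_zero.1
      ((Finset.sum_eq_zero_iff_of_nonneg fun n _ => normSq_nonneg (ψ n)).1 h3 n (Finset.mem_univ n))
  apply hφ
  funext n
  have h5 := hn n
  have h6 : g n * φ n = 0 := congrFun h4 n
  rw [h4, Matrix.mulVec_zero] at h5
  simp only [Pi.zero_apply, mul_zero, sub_zero, zero_add] at h5
  rw [Pi.zero_apply]
  linear_combination h5 + I * h6

/-- **Spectral flow.** Let `A` be Hermitian and let `F` be a loop in `ℝ ∪ {∞}` that is not
homotopic to a constant. Along the loop `y ↦ A + diag (F (y + aₙ))` every real number `E` is attained as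
an eigenvalue. Otherwise the determinant of the pencil would have no zero for `z` in a path
from `-i` to `i` through `E`, and switching off `A` at both ends deforms the constant `1` into the
product of the Cayley transforms, without zeros. -/
theorem exists_mulVec_pencil_eq_zero {ι : Type*} [Fintype ι] [DecidableEq ι] [Nonempty ι]
    {A : Matrix ι ι ℂ} (hA : A.IsHermitian) (F : C(UnitAddCircle, OnePoint ℝ))
    (hF : ¬ F.Nullhomotopic) (a : ι → ℝ) (E : ℝ) :
    ∃ y : UnitAddCircle, ∃ φ ≠ 0,
      (pencil A E fun n => resolventValue (F (y + (a n : UnitAddCircle)))).mulVec φ = 0 := by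
  by_contra hcon
  have hdet : ∀ y : UnitAddCircle,
      (pencil A E fun n => resolventValue (F (y + (a n : UnitAddCircle)))).det ≠ 0 := by
    intro y hy
    exact hcon ⟨y, Matrix.exists_mulVec_eq_zero_iff.2 hy⟩
  have hG := continuous_resolventValue
  let σ : unitInterval → ℝ := fun s => 2 * s - 1
  let τ : unitInterval → ℝ := fun s => 1 - |σ s|
  have hσ : Continuous σ := by fun_prop
  have hτ : Continuous τ := by fun_prop
  have hg : ∀ n, Continuous fun p : unitInterval × UnitAddCircle =>
      resolventValue (F (p.2 + (a n : UnitAddCircle))) := fun n => by fun_prop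
  let H : C(unitInterval × UnitAddCircle, ℂ) :=
    ⟨fun p => (pencil ((τ p.1 : ℂ) • A) (E * τ p.1 + σ p.1 * I)
      fun n => resolventValue (F (p.2 + (a n : UnitAddCircle)))).det, by
        unfold pencil
        refine Continuous.matrix_det ?_
        have h1 : Continuous fun p : unitInterval × UnitAddCircle =>
            Matrix.diagonal fun n => resolventValue (F (p.2 + (a n : UnitAddCircle))) :=
          (continuous_pi hg).matrix_diagonal
        refine Continuous.add (Continuous.matrix_mul ?_ h1) ?_
        · fun_prop
        · fun_prop⟩
  have hH : ∀ p, H p ≠ 0 := by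
    rintro ⟨s, y⟩
    by_cases hs : σ s = 0
    · have : τ s = 1 := by simp [τ, hs]
      simpa [H, hs, this] using hdet y
    · refine det_pencil_ne_zero ?_ ?_ _
      · exact hA.smul (conj_ofReal _)
      · simpa using hs
  obtain ⟨h, hh⟩ := exists_log_of_homotopy H hH 0 (by
    intro y
    have h1 : σ 0 = -1 := by simp [σ]
    have h2 : τ 0 = 0 := by simp [τ, h1]
    simp [H, h1, h2, pencil])
  -- straighten the shifts `aₙ` to `0`
  let H₂ : C(unitInterval × UnitAddCircle, ℂ) :=
    ⟨fun p => ∏ n, (1 - 2 * I * resolventValue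
        (F (p.2 + ((((1 - (p.1 : ℝ)) * a n : ℝ)) : UnitAddCircle)))), by
      refine continuous_finsetProd _ fun n _ => ?_
      have : Continuous fun p : unitInterval × UnitAddCircle =>
          ((((1 - (p.1 : ℝ)) * a n : ℝ)) : UnitAddCircle) :=
        (AddCircle.continuous_mk' 1).comp (by fun_prop)
      fun_prop⟩
  obtain ⟨k, hk⟩ := exists_log_of_homotopy H₂ (fun p => by
      refine Finset.prod_ne_zero_iff.2 fun n _ => ?_
      rw [← norm_ne_zero_iff, norm_cayley]
      exact one_ne_zero) h (by
    intro y
    rw [← hh]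
    have h1 : σ 1 = 1 := by norm_num [σ]
    have h2 : τ 1 = 0 := by simp [τ, h1]
    simp only [H, H₂, ContinuousMap.coe_mk, h1, h2, pencil]
    rw [← Matrix.det_diagonal]
    congr 1
    ext i j
    by_cases hij : i = j
    · subst hij
      simp
      ring
    · simp [hij])
  refine hF (nullhomotopic_of_cayley_pow_eq_exp F (Fintype.card_ne_zero (α := ι)) k fun y => ?_)
  rw [← hk]
  simp [H₂]

/-! ### The lattice Laplacian on `ℓ²(ℤ^d)` -/

theorem memlp_of_norm_le {d : ℕ} {φ ψ : (Fin d → ℤ) → ℂ} (hψ : Memℓp ψ 2)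
    (h : ∀ n, ‖φ n‖ ≤ ‖ψ n‖) : Memℓp φ 2 := by
  have h2 : 0 < (2 : ENNReal).toReal := by norm_num
  rw [memℓp_gen_iff h2] at hψ ⊢
  refine Summable.of_nonneg_of_le (fun n => by positivity) (fun n => ?_) hψ
  gcongr
  exact h n

theorem norm_sq_eq_tsum {d : ℕ} (ψ : L2 d) : ‖ψ‖ ^ 2 = ∑' n, ‖ψ n‖ ^ 2 := by
  have h := lp.norm_rpow_eq_tsum (p := 2) (by norm_num) ψ
  simpa using h

/-- Translation by `m` on `ℓ²(ℤ^d)`. -/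
def shift {d : ℕ} (m : Fin d → ℤ) : L2 d →ₗᵢ[ℂ] L2 d where
  toFun ψ := ⟨fun n => ψ (n + m), memlp_shift (lp.memℓp ψ) m⟩
  map_add' _ _ := rfl
  map_smul' _ _ := rfl
  norm_map' ψ := by
    rw [← sq_eq_sq₀ (norm_nonneg _) (norm_nonneg _), norm_sq_eq_tsum, norm_sq_eq_tsum]
    exact (Equiv.addRight m).tsum_eq fun n => ‖ψ n‖ ^ 2

@[simp] theorem shift_apply {d : ℕ} (m : Fin d → ℤ) (ψ : L2 d) (n : Fin d → ℤ) :
    shift m ψ n = ψ (n + m) := rfl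

theorem inner_shift_left {d : ℕ} (m : Fin d → ℤ) (φ ψ : L2 d) :
    inner ℂ (shift m φ) ψ = inner ℂ φ (shift (-m) ψ) := by
  rw [lp.inner_eq_tsum, lp.inner_eq_tsum,
    ← (Equiv.addRight m).tsum_eq fun n => inner ℂ (φ n) (shift (-m) ψ n)]
  simp

/-- The lattice Laplacian as an operator on `ℓ²(ℤ^d)`. -/
def laplacianL2 {d : ℕ} (ψ : L2 d) : L2 d :=
  ∑ i : Fin d, (shift (Pi.single i 1) ψ + shift (-Pi.single i 1) ψ)

@[simp] theorem laplacianL2_apply {d : ℕ} (ψ : L2 d) (n : Fin d → ℤ) :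
    laplacianL2 ψ n = latticeLaplacian ψ n := by
  rw [laplacianL2, lp.coeFn_sum, Finset.sum_apply, latticeLaplacian]
  rfl

theorem inner_laplacianL2_left {d : ℕ} (φ ψ : L2 d) :
    inner ℂ (laplacianL2 φ) ψ = inner ℂ φ (laplacianL2 ψ) := by
  simp only [laplacianL2, sum_inner, inner_sum, inner_add_left, inner_add_right, inner_shift_left,
    neg_neg]
  exact Finset.sum_congr rfl fun _ _ => add_comm _ _

theorem norm_laplacianL2_le {d : ℕ} (ψ : L2 d) : ‖laplacianL2 ψ‖ ≤ 2 * d * ‖ψ‖ := by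
  calc ‖laplacianL2 ψ‖ ≤ ∑ _i : Fin d, (‖ψ‖ + ‖ψ‖) := by
        refine norm_sum_le_of_le _ fun i _ => (norm_add_le _ _).trans ?_
        rw [LinearIsometry.norm_map, LinearIsometry.norm_map]
    _ = 2 * d * ‖ψ‖ := by
        rw [Finset.sum_const, Finset.card_univ, Fintype.card_fin, nsmul_eq_mul]
        ring

theorem continuous_laplacianL2 {d : ℕ} : Continuous (laplacianL2 : L2 d → L2 d) := by
  unfold laplacianL2
  fun_prop

/-! ### Self-adjointness of the Schrödinger operator -/

theorem schrodinger_apply {d : ℕ} (V : (Fin d → ℤ) → OnePoint ℝ) (ψ : (schrodinger V).domain)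
    (n : Fin d → ℤ) : (schrodinger V ψ : L2 d) n = schrodingerExpr V (ψ : L2 d) n := rfl

theorem schrodinger_sub_smul_apply {d : ℕ} (V : (Fin d → ℤ) → OnePoint ℝ) (z : ℂ)
    (ψ : (schrodinger V).domain) (n : Fin d → ℤ) :
    (schrodinger V ψ - z • (ψ : L2 d) : L2 d) n
      = schrodingerExpr V (ψ : L2 d) n - z * (ψ : L2 d) n := rfl

/-- The vectors of `ℓ²(ℤ^d)` that vanish where `V` is infinite. -/
def finitePotentialSpace {d : ℕ} (V : (Fin d → ℤ) → OnePoint ℝ) : Set (L2 d) :=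
  {ψ | ∀ n, V n = ∞ → ψ n = 0}

theorem continuous_eval {d : ℕ} (n : Fin d → ℤ) : Continuous fun ψ : L2 d => ψ n :=
  (lp.evalCLM (𝕜 := ℂ) (fun _ : Fin d → ℤ => ℂ) 2 n).continuous

theorem isClosed_finitePotentialSpace {d : ℕ} (V : (Fin d → ℤ) → OnePoint ℝ) :
    IsClosed (finitePotentialSpace V) := by
  simp only [finitePotentialSpace, ofPred_forall]
  exact isClosed_iInter fun n => isClosed_iInter fun _ =>
    isClosed_eq (continuous_eval n) continuous_const

theorem single_mem_schrodingerDomain {d : ℕ} {V : (Fin d → ℤ) → OnePoint ℝ} {n : Fin d → ℤ} {c : ℂ}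
    (h : V n = ∞ → c = 0) : (lp.single 2 n c : L2 d) ∈ schrodingerDomain V := by
  refine ⟨fun m hm => ?_, ?_⟩
  · rw [lp.single_apply]
    by_cases hmn : m = n
    · subst hmn
      simpa using h hm
    · simp [hmn]
  · refine memlp_of_norm_le (lp.memℓp (lp.single 2 n ((finitePart (V n) : ℂ) * c) : L2 d))
      fun m => le_of_eq ?_
    by_cases hmn : m = n
    · subst hmn
      simp
    · simp [hmn]

/-- The closure of the domain is `ℓ²` of the set where `V` is finite. -/
theorem closure_schrodingerDomain {d : ℕ} (V : (Fin d → ℤ) → OnePoint ℝ) :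
    closure ((schrodinger V).domain : Set (L2 d)) = finitePotentialSpace V := by
  apply subset_antisymm
  · exact closure_minimal (fun ψ hψ => hψ.1) (isClosed_finitePotentialSpace V)
  · intro ψ hψ
    refine mem_closure_of_tendsto (lp.hasSum_single (by norm_num) ψ) (Eventually.of_forall ?_)
    exact fun s => Submodule.sum_mem _ fun n _ => single_mem_schrodingerDomain (hψ n)

theorem schrodinger_sub_smul_mem {d : ℕ} (V : (Fin d → ℤ) → OnePoint ℝ) (z : ℂ)
    (ψ : (schrodinger V).domain) :
    schrodinger V ψ - z • (ψ : L2 d) ∈ finitePotentialSpace V := by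
  intro n hn
  have h : (ψ : L2 d) n = 0 := ψ.2.1 n hn
  rw [schrodinger_sub_smul_apply]
  simp [schrodingerExpr, hn, h]

/-- The vector `V ψ` for `ψ` in the domain of the Schrödinger operator. -/
def potentialTerm {d : ℕ} (V : (Fin d → ℤ) → OnePoint ℝ) (ψ : (schrodinger V).domain) : L2 d :=
  ⟨fun n => (finitePart (V n) : ℂ) * (ψ : L2 d) n, ψ.2.2⟩

@[simp] theorem potentialTerm_apply {d : ℕ} (V : (Fin d → ℤ) → OnePoint ℝ)
    (ψ : (schrodinger V).domain) (n : Fin d → ℤ) :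
    potentialTerm V ψ n = (finitePart (V n) : ℂ) * (ψ : L2 d) n := rfl

theorem inner_schrodinger_left {d : ℕ} (V : (Fin d → ℤ) → OnePoint ℝ) (ψ : (schrodinger V).domain)
    {φ : L2 d} (hφ : φ ∈ finitePotentialSpace V) :
    inner ℂ (schrodinger V ψ) φ
      = inner ℂ (laplacianL2 (ψ : L2 d)) φ + inner ℂ (potentialTerm V ψ) φ := by
  rw [← inner_add_left, lp.inner_eq_tsum, lp.inner_eq_tsum]
  refine tsum_congr fun n => ?_
  by_cases hn : V n = ∞
  · rw [hφ n hn, inner_zero_right, inner_zero_right]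
  · congr 1
    simp [schrodinger_apply, schrodingerExpr, hn]

theorem inner_schrodinger_self_im {d : ℕ} (V : (Fin d → ℤ) → OnePoint ℝ)
    (ψ : (schrodinger V).domain) :
    (inner ℂ (schrodinger V ψ) (ψ : L2 d)).im = 0 := by
  rw [← Complex.conj_eq_iff_im, inner_conj_symm, ← inner_conj_symm,
    inner_schrodinger_left V ψ ψ.2.1, map_add, inner_conj_symm, inner_conj_symm,
    inner_laplacianL2_left]
  congr 1
  rw [lp.inner_eq_tsum, lp.inner_eq_tsum]
  refine tsum_congr fun n => ?_
  simp
  ring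

theorem abs_im_mul_norm_le {d : ℕ} (V : (Fin d → ℤ) → OnePoint ℝ) (z : ℂ)
    (ψ : (schrodinger V).domain) :
    |z.im| * ‖(ψ : L2 d)‖ ≤ ‖schrodinger V ψ - z • (ψ : L2 d)‖ := by
  have h1 : (inner ℂ (schrodinger V ψ - z • (ψ : L2 d)) (ψ : L2 d)).im
      = z.im * ‖(ψ : L2 d)‖ ^ 2 := by
    rw [inner_sub_left, Complex.sub_im, inner_schrodinger_self_im, inner_smul_left,
      inner_self_eq_norm_sq_to_K]
    simp [← Complex.ofReal_pow]
  have h2 : |z.im| * ‖(ψ : L2 d)‖ ^ 2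
      ≤ ‖schrodinger V ψ - z • (ψ : L2 d)‖ * ‖(ψ : L2 d)‖ := by
    rw [← abs_of_nonneg (sq_nonneg ‖(ψ : L2 d)‖), ← abs_mul, ← h1]
    exact (Complex.abs_im_le_norm _).trans (norm_inner_le_norm _ _)
  rcases (norm_nonneg (ψ : L2 d)).eq_or_lt with h0 | h0
  · rw [← h0, mul_zero]
    exact norm_nonneg _
  · refine le_of_mul_le_mul_right ?_ h0
    linarith [h2, sq ‖(ψ : L2 d)‖]

/-- `ψ ↦ H ψ - z ψ` as a linear map on the domain. -/
def schrodingerSub {d : ℕ} (V : (Fin d → ℤ) → OnePoint ℝ) (z : ℂ) :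
    (schrodinger V).domain →ₗ[ℂ] L2 d :=
  (schrodinger V).toFun - z • (schrodinger V).domain.subtype

theorem schrodingerSub_apply {d : ℕ} (V : (Fin d → ℤ) → OnePoint ℝ) (z : ℂ)
    (ψ : (schrodinger V).domain) :
    schrodingerSub V z ψ = schrodinger V ψ - z • (ψ : L2 d) := rfl

theorem isClosed_range_schrodingerSub {d : ℕ} (V : (Fin d → ℤ) → OnePoint ℝ) {z : ℂ}
    (hz : z.im ≠ 0) : IsClosed (LinearMap.range (schrodingerSub V z) : Set (L2 d)) := by
  refine IsSeqClosed.isClosed fun u φ hu huφ => ?_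
  choose ψ hψ using hu
  have hz' : 0 < |z.im| := abs_pos.2 hz
  have hcauchy : CauchySeq fun k => ((ψ k : (schrodinger V).domain) : L2 d) := by
    rw [Metric.cauchySeq_iff]
    intro ε hε
    obtain ⟨N, hN⟩ := Metric.cauchySeq_iff.1 huφ.cauchySeq (|z.im| * ε) (by positivity)
    refine ⟨N, fun k hk l hl => ?_⟩
    have h1 := hN k hk l hl
    have h2 := abs_im_mul_norm_le V z (ψ k - ψ l)
    rw [← schrodingerSub_apply, map_sub, hψ, hψ, ← dist_eq_norm] at h2
    rw [dist_eq_norm]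
    exact lt_of_mul_lt_mul_left (h2.trans_lt h1) hz'.le
  obtain ⟨χ, hχ⟩ := cauchySeq_tendsto_of_complete hcauchy
  have hχK : χ ∈ finitePotentialSpace V :=
    (isClosed_finitePotentialSpace V).mem_of_tendsto hχ (Eventually.of_forall fun k => (ψ k).2.1)
  have hlap := (continuous_laplacianL2.tendsto χ).comp hχ
  -- the equation `H ψ - z ψ = u` passes to the limit pointwise
  have hpt : ∀ n, {m | V m ≠ ∞}.indicator (latticeLaplacian χ) n
      + (finitePart (V n) : ℂ) * χ n - z * χ n = φ n := by
    intro n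
    have e1 := ((continuous_eval n).tendsto χ).comp hχ
    have e2 := ((continuous_eval n).tendsto φ).comp huφ
    have e3 := ((continuous_eval n).tendsto _).comp hlap
    simp only [Function.comp_def, laplacianL2_apply] at e1 e2 e3
    have e4 : Tendsto (fun k => {m | V m ≠ ∞}.indicator
        (latticeLaplacian ((ψ k : (schrodinger V).domain) : L2 d)) n) atTop
        (𝓝 ({m | V m ≠ ∞}.indicator (latticeLaplacian χ) n)) := by
      by_cases hn : V n = ∞
      · simp [hn]
      · simpa [hn] using e3
    refine tendsto_nhds_unique ((e4.add (e1.const_mul _)).sub (e1.const_mul z)) ?_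
    refine e2.congr fun k => ?_
    rw [← hψ k]
    rfl
  have hdom : χ ∈ (schrodinger V).domain := by
    refine ⟨hχK, ?_⟩
    have h := ((lp.memℓp φ).add ((lp.memℓp χ).const_mul z)).sub
      (memlp_indicator (memlp_laplacian (lp.memℓp χ)) {m | V m ≠ ∞})
    refine (congrArg (fun g : (Fin d → ℤ) → ℂ => Memℓp g 2) ?_).mp h
    funext n
    simp only [Pi.add_apply, Pi.sub_apply]
    linear_combination -(hpt n)
  refine ⟨⟨χ, hdom⟩, ?_⟩
  ext n
  exact hpt n

/-- The range of `H - z` is closed, and a vector orthogonal to it that vanishes where `V` is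
infinite lies in the domain and is an eigenvector for `conj z`, hence zero. -/
theorem exists_schrodinger_sub_smul_eq {d : ℕ} (V : (Fin d → ℤ) → OnePoint ℝ) {z : ℂ}
    (hz : z.im ≠ 0) {φ : L2 d} (hφ : φ ∈ finitePotentialSpace V) :
    ∃ ψ : (schrodinger V).domain, schrodinger V ψ - z • (ψ : L2 d) = φ := by
  let S : Submodule ℂ (L2 d) := LinearMap.range (schrodingerSub V z)
  have : CompleteSpace S := (isClosed_range_schrodingerSub V hz).completeSpace_coe
  obtain ⟨s, hs, t, ht, hst⟩ := S.exists_add_mem_mem_orthogonal φ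
  obtain ⟨ψ, hψ⟩ := hs
  suffices t = 0 by
    refine ⟨ψ, ?_⟩
    rw [← schrodingerSub_apply, hψ, hst, this, add_zero]
  have htK : t ∈ finitePotentialSpace V := by
    intro n hn
    have h1 : s n = 0 := by
      rw [← hψ]
      exact schrodinger_sub_smul_mem V z ψ n hn
    have h2 : φ n = s n + t n := by rw [hst]; rfl
    rwa [hφ n hn, h1, zero_add, eq_comm] at h2
  -- testing against `H δₙ - z δₙ` shows that `t` is an eigenvector for `conj z`
  have hpt : ∀ n, V n ≠ ∞ → latticeLaplacian t n + (finitePart (V n) : ℂ) * t n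
      - conj z * t n = 0 := by
    intro n hn
    let δ : (schrodinger V).domain :=
      ⟨lp.single 2 n 1, single_mem_schrodingerDomain fun h => absurd h hn⟩
    have h1 : inner ℂ (schrodingerSub V z δ) t = 0 := ht _ ⟨δ, rfl⟩
    have h2 : potentialTerm V δ = (finitePart (V n) : ℂ) • (lp.single 2 n 1 : L2 d) := by
      ext m
      rw [lp.coeFn_smul, Pi.smul_apply, smul_eq_mul, potentialTerm_apply]
      by_cases hmn : m = n
      · rw [hmn]
      · simp [δ, hmn]
    rw [schrodingerSub_apply, inner_sub_left, inner_schrodinger_left V δ htK,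
      inner_laplacianL2_left, h2, inner_smul_left, inner_smul_left] at h1
    simpa [δ, lp.inner_single_left] using h1
  have htdom : t ∈ (schrodinger V).domain := by
    refine ⟨htK, ?_⟩
    have h := ((lp.memℓp t).const_mul (conj z)).sub
      (memlp_indicator (memlp_laplacian (lp.memℓp t)) {m | V m ≠ ∞})
    refine (congrArg (fun g : (Fin d → ℤ) → ℂ => Memℓp g 2) ?_).mp h
    funext n
    by_cases hn : V n = ∞
    · simp [hn, htK n hn]
    · simp only [Pi.sub_apply, mem_ofPred_eq, hn, not_false_eq_true, indicator_of_mem, ne_eq]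
      linear_combination -(hpt n hn)
  have h0 : schrodinger V ⟨t, htdom⟩ - conj z • t = 0 := by
    ext n
    by_cases hn : V n = ∞
    · exact schrodinger_sub_smul_mem V (conj z) ⟨t, htdom⟩ n hn
    · have := hpt n hn
      rw [schrodinger_sub_smul_apply V (conj z) ⟨t, htdom⟩]
      simpa [schrodingerExpr, hn] using this
  have h1 := abs_im_mul_norm_le V (conj z) ⟨t, htdom⟩
  rw [h0, norm_zero, conj_im, abs_neg] at h1
  have h2 : ‖t‖ ≤ 0 := by
    by_contra hlt
    push Not at hlt
    have := mul_pos (abs_pos.2 hz) hlt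
    linarith
  exact norm_le_zero_iff.1 h2

theorem mem_unboundedResolventSet_of_im_ne_zero {d : ℕ} (V : (Fin d → ℤ) → OnePoint ℝ) {z : ℂ}
    (hz : z.im ≠ 0) : z ∈ unboundedResolventSet (schrodinger V) := by
  have hz' : 0 < |z.im| := abs_pos.2 hz
  refine ⟨⟨?_, ?_, ?_⟩, |z.im|⁻¹, fun ψ => ?_⟩
  · intro ψ _
    rw [closure_schrodingerDomain]
    exact schrodinger_sub_smul_mem V z ψ
  · intro ψ _ φ _ h
    have h1 := abs_im_mul_norm_le V z (ψ - φ)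
    rw [← schrodingerSub_apply, map_sub, schrodingerSub_apply, schrodingerSub_apply,
      sub_eq_zero.2 h, norm_zero] at h1
    have h2 : ‖((ψ - φ : (schrodinger V).domain) : L2 d)‖ ≤ 0 := by
      by_contra hlt
      push Not at hlt
      have := mul_pos hz' hlt
      linarith
    exact sub_eq_zero.1 (Subtype.ext (norm_le_zero_iff.1 h2))
  · intro φ hφ
    rw [closure_schrodingerDomain] at hφ
    obtain ⟨ψ, hψ⟩ := exists_schrodinger_sub_smul_eq V hz hφ
    exact ⟨ψ, mem_univ _, hψ⟩
  · rw [← div_eq_inv_mul, le_div_iff₀' hz']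
    exact abs_im_mul_norm_le V z ψ

/-! ### Generalized eigenfunctions of periodic approximants -/

/-- The adjacency matrix of the discrete torus `(ℤ / N)^d`, with multiplicities when `N ≤ 2`. -/
def torusAdjacency (d N : ℕ) : Matrix (Fin d → ZMod N) (Fin d → ZMod N) ℂ :=
  Matrix.of fun n m =>
    ∑ i : Fin d, ((if m = n + Pi.single i 1 then 1 else 0)
      + (if m = n - Pi.single i 1 then 1 else 0))

theorem torusAdjacency_isHermitian (d N : ℕ) : (torusAdjacency d N).IsHermitian := by
  ext n m
  simp only [Matrix.conjTranspose_apply, torusAdjacency, Matrix.of_apply, star_sum, star_add]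
  refine Finset.sum_congr rfl fun i _ => ?_
  have h1 : n = m + Pi.single i 1 ↔ m = n - Pi.single i 1 := by
    rw [eq_sub_iff_add_eq, eq_comm]
  have h2 : n = m - Pi.single i 1 ↔ m = n + Pi.single i 1 := by
    rw [eq_sub_iff_add_eq, eq_comm]
  simp only [h1, h2, apply_ite star, star_one, star_zero]
  exact add_comm _ _

theorem torusAdjacency_mulVec {d N : ℕ} [NeZero N] (ψ : (Fin d → ZMod N) → ℂ)
    (n : Fin d → ZMod N) :
    (torusAdjacency d N).mulVec ψ n
      = ∑ i : Fin d, (ψ (n + Pi.single i 1) + ψ (n - Pi.single i 1)) := by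
  simp only [Matrix.mulVec, dotProduct, torusAdjacency, Matrix.of_apply, Finset.sum_mul]
  rw [Finset.sum_comm]
  refine Finset.sum_congr rfl fun i _ => ?_
  simp [add_mul, Finset.sum_add_distrib]

/-- The expression `(Δ - z) (g φ) + (1 - i g) φ`. For `g = 1 / (V + i)` and `ψ = g φ`, it equals
`(Δ + V - z) ψ` wherever `V` is finite. -/
def latticePencil {d : ℕ} (z : ℂ) (g φ : (Fin d → ℤ) → ℂ) (n : Fin d → ℤ) : ℂ :=
  latticeLaplacian (fun m => g m * φ m) n - z * (g n * φ n) + (1 - I * g n) * φ n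

theorem unitAddCircle_coe_sum {ι : Type*} (s : Finset ι) (u : ι → ℝ) :
    ((∑ i ∈ s, u i : ℝ) : UnitAddCircle) = ∑ i ∈ s, (u i : UnitAddCircle) :=
  map_sum (QuotientAddGroup.mk' (AddSubgroup.zmultiples (1 : ℝ))) u s

/-- For rational frequencies every real `E` is an energy with a bounded generalized eigenfunction,
here normalized to have its maximum modulus `1` at the origin. -/
theorem exists_bounded_latticePencil_eq_zero {d N : ℕ} [NeZero N] (p : Fin d → ℤ)
    (F : C(UnitAddCircle, OnePoint ℝ)) (hF : ¬ F.Nullhomotopic) (E : ℝ) :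
    ∃ y : UnitAddCircle, ∃ φ : (Fin d → ℤ) → ℂ, ‖φ 0‖ = 1 ∧ (∀ n, ‖φ n‖ ≤ 1) ∧
      ∀ n, latticePencil E (fun m => resolventValue
        (F (y + ((∑ i, (m i : ℝ) * (p i / N) : ℝ) : UnitAddCircle)))) φ n = 0 := by
  let a : (Fin d → ZMod N) → ℝ := fun n => ∑ i, (n i).val * (p i / N)
  let b : (Fin d → ZMod N) → UnitAddCircle := fun n => ∑ i, p i • ZMod.toAddCircle (n i)
  let c : (Fin d → ℤ) → Fin d → ZMod N := fun n i => n i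
  have hab : ∀ n, (a n : UnitAddCircle) = b n := by
    intro n
    simp only [a, b, unitAddCircle_coe_sum, ZMod.toAddCircle_apply, ← AddCircle.coe_zsmul]
    refine Finset.sum_congr rfl fun i _ => ?_
    congr 1
    rw [zsmul_eq_mul]
    ring
  have hbc : ∀ m : Fin d → ℤ, ((∑ i, (m i : ℝ) * (p i / N) : ℝ) : UnitAddCircle) = b (c m) := by
    intro n
    simp only [b, c, unitAddCircle_coe_sum, ZMod.toAddCircle_intCast, ← AddCircle.coe_zsmul]
    refine Finset.sum_congr rfl fun i _ => ?_
    congr 1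
    rw [zsmul_eq_mul]
    ring
  have hb : ∀ m n, b (m + n) = b m + b n := by
    intro m n
    simp [b, Finset.sum_add_distrib]
  obtain ⟨y, φ, hφ, h0⟩ :=
    exists_mulVec_pencil_eq_zero (torusAdjacency_isHermitian d N) F hF a E
  obtain ⟨n₀, hn₀⟩ := Finite.exists_max fun n => ‖φ n‖
  have hpos : φ n₀ ≠ 0 := by
    intro h
    apply hφ
    funext n
    have := hn₀ n
    rw [h, norm_zero] at this
    exact norm_le_zero_iff.1 this
  refine ⟨y + b n₀, fun n => φ (c n + n₀) / φ n₀, ?_, fun n => ?_, fun n => ?_⟩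
  · have : c 0 = 0 := by
      funext i
      simp [c]
    simp [this, hpos]
  · rw [norm_div]
    exact div_le_one_of_le₀ (hn₀ _) (norm_nonneg _)
  · have h1 := congrFun h0 (c n + n₀)
    rw [pencil_mulVec, torusAdjacency_mulVec, Pi.zero_apply] at h1
    have hc1 : ∀ i, c (n + Pi.single i 1) = c n + Pi.single i 1 := by
      intro i
      funext j
      by_cases hij : j = i
      · subst hij
        simp [c]
      · simp [c, hij]
    have hc2 : ∀ i, c (n - Pi.single i 1) = c n - Pi.single i 1 := by
      intro i
      funext j
      by_cases hij : j = i
      · subst hij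
        simp [c]
      · simp [c, hij]
    have hg : ∀ m, y + b n₀ + b m = y + b (m + n₀) := by
      intro m
      rw [hb]
      abel
    simp only [latticePencil, latticeLaplacian, hbc, hg, hc1, hc2]
    simp only [hab] at h1
    have h2 : ∀ i : Fin d, c n + Pi.single i 1 + n₀ = c n + n₀ + Pi.single i 1 :=
      fun i => add_right_comm _ _ _
    have h3 : ∀ i : Fin d, c n - Pi.single i 1 + n₀ = c n + n₀ - Pi.single i 1 :=
      fun i => sub_add_eq_add_sub _ _ _
    simp only [h2, h3, mul_div_assoc', ← add_div, ← Finset.sum_div, ← sub_div]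
    rw [h1, zero_div]

/-! ### Exponential weights -/

theorem summable_prod_apply {u : ℤ → ℝ} (hu : Summable u) (h0 : ∀ k, 0 ≤ u k) (d : ℕ) :
    Summable fun n : Fin d → ℤ => ∏ i, u (n i) := by
  induction d with
  | zero => exact Summable.of_finite
  | succ d ih =>
    rw [← (Fin.consEquiv fun _ : Fin (d + 1) => ℤ).summable_iff]
    have := hu.mul_of_nonneg ih h0 fun n => Finset.prod_nonneg fun i _ => h0 _
    refine this.congr fun q => ?_
    simp [Fin.prod_univ_succ, Fin.consEquiv]

/-- The weight `exp (-κ |n|₁)` on `ℤ^d`. -/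
def expWeight {d : ℕ} (κ : ℝ) (n : Fin d → ℤ) : ℝ := Real.exp (-(κ * ∑ i, |(n i : ℝ)|))

theorem expWeight_pos {d : ℕ} (κ : ℝ) (n : Fin d → ℤ) : 0 < expWeight κ n := Real.exp_pos _

theorem summable_expWeight_sq {d : ℕ} {κ : ℝ} (hκ : 0 < κ) :
    Summable fun n : Fin d → ℤ => expWeight κ n ^ 2 := by
  have hgeom : Summable fun k : ℕ => Real.exp (-(2 * κ)) ^ k :=
    summable_geometric_of_lt_one (Real.exp_pos _).le (by
      rw [Real.exp_lt_one_iff]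
      linarith)
  have h1 : Summable fun k : ℤ => Real.exp (-(2 * κ * |(k : ℝ)|)) := by
    refine Summable.of_nat_of_neg ?_ ?_
    · refine hgeom.congr fun k => ?_
      rw [← Real.exp_nat_mul]
      simp
      ring
    · refine hgeom.congr fun k => ?_
      rw [← Real.exp_nat_mul]
      simp
      ring
  refine (summable_prod_apply h1 (fun k => (Real.exp_pos _).le) d).congr fun n => ?_
  rw [expWeight, ← Real.exp_sum, ← Real.exp_nat_mul, Finset.sum_neg_distrib, ← Finset.mul_sum]
  congr 1
  push_cast
  ring

theorem abs_expWeight_sub_le {d : ℕ} {κ : ℝ} (hκ : 0 ≤ κ) (m n : Fin d → ℤ)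
    (h : ∑ i, |((m i - n i : ℤ) : ℝ)| ≤ 1) :
    |expWeight κ m - expWeight κ n| ≤ (Real.exp κ - 1) * expWeight κ m := by
  have h1 : ∑ i, |(m i : ℝ)| ≤ ∑ i, |(n i : ℝ)| + 1 := by
    refine le_trans ?_ (add_le_add_right h _)
    rw [← Finset.sum_add_distrib]
    refine Finset.sum_le_sum fun i _ => ?_
    push_cast
    have := abs_add_le (n i : ℝ) ((m i : ℝ) - n i)
    simpa using this
  have h2 : ∑ i, |(n i : ℝ)| ≤ ∑ i, |(m i : ℝ)| + 1 := by
    refine le_trans ?_ (add_le_add_right h _)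
    rw [← Finset.sum_add_distrib]
    refine Finset.sum_le_sum fun i _ => ?_
    push_cast
    have := abs_sub_abs_le_abs_sub (n i : ℝ) (m i)
    rw [abs_sub_comm] at this
    linarith
  have e1 : expWeight κ n ≤ Real.exp κ * expWeight κ m := by
    rw [expWeight, expWeight, ← Real.exp_add]
    refine Real.exp_le_exp.2 ?_
    nlinarith
  have e2 : Real.exp (-κ) * expWeight κ m ≤ expWeight κ n := by
    rw [expWeight, expWeight, ← Real.exp_add]
    refine Real.exp_le_exp.2 ?_
    nlinarith
  have e3 : 2 - Real.exp κ ≤ Real.exp (-κ) := by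
    have h3 : Real.exp κ * Real.exp (-κ) = 1 := by rw [← Real.exp_add]; simp
    nlinarith [sq_nonneg (Real.exp κ - 1), Real.exp_pos κ, Real.exp_pos (-κ),
      Real.one_le_exp hκ, sq_nonneg (Real.exp (-κ) - 1)]
  have e4 := expWeight_pos κ m
  rw [abs_le]
  constructor
  · linarith
  · nlinarith

/-! ### Lower bounds for the pencil on the resolvent set -/

/-- The vector `χ / (V + i)`, which lies in the domain of the Schrödinger operator. -/
def resolventMul {d : ℕ} (V : (Fin d → ℤ) → OnePoint ℝ) (χ : L2 d) : L2 d :=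
  ⟨fun n => resolventValue (V n) * χ n, memlp_of_norm_le (lp.memℓp χ) fun n => by
    rw [norm_mul]
    exact mul_le_of_le_one_left (norm_nonneg _) (norm_resolventValue_le_one _)⟩

@[simp] theorem resolventMul_apply {d : ℕ} (V : (Fin d → ℤ) → OnePoint ℝ) (χ : L2 d)
    (n : Fin d → ℤ) : resolventMul V χ n = resolventValue (V n) * χ n := rfl

theorem resolventMul_mem {d : ℕ} (V : (Fin d → ℤ) → OnePoint ℝ) (χ : L2 d) :
    resolventMul V χ ∈ (schrodinger V).domain := by
  refine ⟨fun n hn => by simp [hn], ?_⟩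
  have h := memlp_indicator ((lp.memℓp χ).sub ((lp.memℓp (resolventMul V χ)).const_mul I))
    {m | V m ≠ ∞}
  refine (congrArg (fun g : (Fin d → ℤ) → ℂ => Memℓp g 2) ?_).mp h
  funext n
  by_cases hn : V n = ∞
  · simp [hn]
  · have h1 := finitePart_mul_resolventValue_of_ne hn
    simp only [ne_eq, mem_ofPred_eq, hn, not_false_eq_true, indicator_of_mem, Pi.sub_apply,
      resolventMul_apply]
    linear_combination -(χ n) * h1

/-- The expression `latticePencil` as an operator on `ℓ²(ℤ^d)`. -/
def pencilL2 {d : ℕ} (V : (Fin d → ℤ) → OnePoint ℝ) (z : ℂ) (χ : L2 d) : L2 d :=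
  laplacianL2 (resolventMul V χ) - z • resolventMul V χ + (χ - I • resolventMul V χ)

theorem pencilL2_apply {d : ℕ} (V : (Fin d → ℤ) → OnePoint ℝ) (z : ℂ) (χ : L2 d)
    (n : Fin d → ℤ) :
    pencilL2 V z χ n = latticePencil z (fun m => resolventValue (V m)) χ n := by
  have : pencilL2 V z χ n = laplacianL2 (resolventMul V χ) n - z * resolventMul V χ n
      + (χ n - I * resolventMul V χ n) := rfl
  rw [this, laplacianL2_apply, latticePencil, resolventMul_apply, sub_mul, one_mul, mul_assoc]
  rfl

theorem norm_le_of_resolvent_bound {d : ℕ} {V : (Fin d → ℤ) → OnePoint ℝ} {z : ℂ} {C : ℝ}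
    (hC0 : 0 ≤ C)
    (hC : ∀ ψ : (schrodinger V).domain, ‖(ψ : L2 d)‖ ≤ C * ‖schrodinger V ψ - z • (ψ : L2 d)‖)
    (χ : L2 d) : ‖χ‖ ≤ (1 + (2 * d + ‖z + I‖) * C) * ‖pencilL2 V z χ‖ := by
  have h1 := hC ⟨resolventMul V χ, resolventMul_mem V χ⟩
  have h2 : ‖schrodinger V ⟨resolventMul V χ, resolventMul_mem V χ⟩ - z • resolventMul V χ‖
      ≤ ‖pencilL2 V z χ‖ := by
    refine lp.norm_mono (by norm_num) fun n => ?_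
    by_cases hn : V n = ∞
    · rw [schrodinger_sub_smul_mem V z ⟨resolventMul V χ, resolventMul_mem V χ⟩ n hn, norm_zero]
      exact norm_nonneg _
    · refine le_of_eq (congrArg _ ?_)
      rw [schrodinger_sub_smul_apply V z ⟨resolventMul V χ, resolventMul_mem V χ⟩, pencilL2_apply]
      have h3 := finitePart_mul_resolventValue_of_ne hn
      simp only [schrodingerExpr, ne_eq, mem_ofPred_eq, hn, not_false_eq_true, indicator_of_mem,
        latticePencil, resolventMul_apply]
      change latticeLaplacian (fun m => resolventValue (V m) * χ m) n + _ - _ = _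
      linear_combination χ n * h3
  have h4 : ‖resolventMul V χ‖ ≤ C * ‖pencilL2 V z χ‖ :=
    h1.trans (mul_le_mul_of_nonneg_left h2 hC0)
  have h5 : χ = pencilL2 V z χ - laplacianL2 (resolventMul V χ) + (z + I) • resolventMul V χ := by
    rw [pencilL2, add_smul]
    abel
  have h6 : ‖χ‖ ≤ ‖pencilL2 V z χ‖ + 2 * d * ‖resolventMul V χ‖
      + ‖z + I‖ * ‖resolventMul V χ‖ := by
    conv_lhs => rw [h5]
    refine (norm_add_le _ _).trans (add_le_add ((norm_sub_le _ _).trans ?_) (norm_smul_le _ _))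
    exact add_le_add_right (norm_laplacianL2_le _) _
  have h7 : (2 * d + ‖z + I‖) * ‖resolventMul V χ‖
      ≤ (2 * d + ‖z + I‖) * (C * ‖pencilL2 V z χ‖) :=
    mul_le_mul_of_nonneg_left h4 (by positivity)
  linarith

theorem norm_pencilL2_translate {d : ℕ} (V : (Fin d → ℤ) → OnePoint ℝ) (z : ℂ) (χ : L2 d)
    (m : Fin d → ℤ) : ‖pencilL2 V z (shift (-m) χ)‖ = ‖pencilL2 (fun n => V (n + m)) z χ‖ := by
  rw [← LinearIsometry.norm_map (shift m)]
  congr 1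
  ext n
  rw [shift_apply, pencilL2_apply, pencilL2_apply]
  simp only [latticePencil, latticeLaplacian, shift_apply, add_neg_cancel_right,
    neg_add_cancel_right, add_right_comm n m, ← sub_add_eq_add_sub]

theorem norm_pencilL2_le_add {d : ℕ} (V W : (Fin d → ℤ) → OnePoint ℝ) (z : ℂ) (χ : L2 d) :
    ‖pencilL2 V z χ‖ ≤ ‖pencilL2 W z χ‖
      + (2 * d + ‖z + I‖) * ‖resolventMul V χ - resolventMul W χ‖ := by
  have hlap : ∀ φ ψ : L2 d, laplacianL2 (φ - ψ) = laplacianL2 φ - laplacianL2 ψ := by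
    intro φ ψ
    simp only [laplacianL2, map_sub, ← Finset.sum_sub_distrib]
    exact Finset.sum_congr rfl fun i _ => by abel
  have h : pencilL2 V z χ = pencilL2 W z χ
      + (laplacianL2 (resolventMul V χ - resolventMul W χ)
        - (z + I) • (resolventMul V χ - resolventMul W χ)) := by
    rw [hlap, pencilL2, pencilL2, add_smul, smul_sub, smul_sub]
    abel
  rw [h, add_mul]
  refine (norm_add_le _ _).trans (add_le_add_right ((norm_sub_le _ _).trans ?_) _)
  exact add_le_add (norm_laplacianL2_le _) (norm_smul_le _ _)

/-! ### Damped generalized eigenfunctions -/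

/-- A bounded function multiplied by the exponential weight. -/
def damped {d : ℕ} {κ : ℝ} (hκ : 0 < κ) (φ : (Fin d → ℤ) → ℂ) (hφ : ∀ n, ‖φ n‖ ≤ 1) : L2 d :=
  ⟨fun n => expWeight κ n * φ n, by
    have h2 : 0 < (2 : ENNReal).toReal := by norm_num
    have h : Memℓp (fun n : Fin d → ℤ => (expWeight κ n : ℂ)) 2 := by
      rw [memℓp_gen_iff h2]
      simpa using summable_expWeight_sq hκ
    refine memlp_of_norm_le h fun n => ?_
    rw [norm_mul]
    exact mul_le_of_le_one_right (norm_nonneg _) (hφ n)⟩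

@[simp] theorem damped_apply {d : ℕ} {κ : ℝ} (hκ : 0 < κ) (φ : (Fin d → ℤ) → ℂ)
    (hφ : ∀ n, ‖φ n‖ ≤ 1) (n : Fin d → ℤ) : damped hκ φ hφ n = expWeight κ n * φ n := rfl

theorem norm_damped_apply_le {d : ℕ} {κ : ℝ} (hκ : 0 < κ) (φ : (Fin d → ℤ) → ℂ)
    (hφ : ∀ n, ‖φ n‖ ≤ 1) (n : Fin d → ℤ) : ‖damped hκ φ hφ n‖ ≤ expWeight κ n := by
  rw [damped_apply, norm_mul, Complex.norm_real, Real.norm_of_nonneg (expWeight_pos κ n).le]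
  exact mul_le_of_le_one_right (expWeight_pos κ n).le (hφ n)

/-- The weight changes slowly between neighbours, so a damped generalized eigenfunction is an
approximate eigenfunction. -/
theorem norm_pencilL2_damped_le {d : ℕ} {κ : ℝ} (hκ : 0 < κ) (φ : (Fin d → ℤ) → ℂ)
    (hφ : ∀ n, ‖φ n‖ ≤ 1) (V : (Fin d → ℤ) → OnePoint ℝ) (z : ℂ)
    (h0 : ∀ n, latticePencil z (fun m => resolventValue (V m)) φ n = 0) :
    ‖pencilL2 V z (damped hκ φ hφ)‖
      ≤ (Real.exp κ - 1) * (2 * d * ‖damped hκ φ hφ‖) := by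
  set χ := damped hκ φ hφ with hχ
  have hη : 0 ≤ Real.exp κ - 1 := sub_nonneg.2 (Real.one_le_exp hκ.le)
  let ν : L2 d := ⟨fun n => (‖χ n‖ : ℂ), memlp_of_norm_le (lp.memℓp χ) fun n => by simp⟩
  have hν : ‖ν‖ ≤ ‖χ‖ := lp.norm_mono (by norm_num) fun n => by simp [ν]
  have hpt : ∀ n, ‖pencilL2 V z χ n‖ ≤ ‖(((Real.exp κ - 1 : ℝ) : ℂ) • laplacianL2 ν : L2 d) n‖ := by
    intro n
    have hstep : ∀ m : Fin d → ℤ, ∑ i, |((m i - n i : ℤ) : ℝ)| ≤ 1 →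
        ‖((expWeight κ m - expWeight κ n : ℝ) : ℂ) * (resolventValue (V m) * φ m)‖
          ≤ (Real.exp κ - 1) * ‖χ m‖ := by
      intro m hm
      have h1 : ‖χ m‖ = expWeight κ m * ‖φ m‖ := by
        rw [hχ, damped_apply, norm_mul, Complex.norm_real,
          Real.norm_of_nonneg (expWeight_pos κ m).le]
      rw [norm_mul, Complex.norm_real, Real.norm_eq_abs, h1, ← mul_assoc]
      refine mul_le_mul (abs_expWeight_sub_le hκ.le m n hm) ?_ (norm_nonneg _)
        (mul_nonneg hη (expWeight_pos κ m).le)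
      rw [norm_mul]
      exact mul_le_of_le_one_left (norm_nonneg _) (norm_resolventValue_le_one _)
    have hnb1 : ∀ i : Fin d,
        ∑ j, |(((n + Pi.single i 1 : Fin d → ℤ) j - n j : ℤ) : ℝ)| ≤ 1 := by
      intro i
      simp [Pi.single_apply, apply_ite abs]
    have hnb2 : ∀ i : Fin d,
        ∑ j, |(((n - Pi.single i 1 : Fin d → ℤ) j - n j : ℤ) : ℝ)| ≤ 1 := by
      intro i
      simp [Pi.single_apply, apply_ite abs]
    have hcomm : pencilL2 V z χ n = ∑ i : Fin d,
        (((expWeight κ (n + Pi.single i 1) - expWeight κ n : ℝ) : ℂ)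
            * (resolventValue (V (n + Pi.single i 1)) * φ (n + Pi.single i 1))
          + ((expWeight κ (n - Pi.single i 1) - expWeight κ n : ℝ) : ℂ)
            * (resolventValue (V (n - Pi.single i 1)) * φ (n - Pi.single i 1))) := by
      have h1 := h0 n
      simp only [latticePencil, latticeLaplacian] at h1
      have h2 : ∀ S S' : ℂ, S' = S - expWeight κ n * ∑ i : Fin d,
          (resolventValue (V (n + Pi.single i 1)) * φ (n + Pi.single i 1)
          + resolventValue (V (n - Pi.single i 1)) * φ (n - Pi.single i 1)) →
          S - z * (resolventValue (V n) * χ n) + (1 - I * resolventValue (V n)) * χ n = S' := by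
        intro S S' hS
        rw [hS, hχ, damped_apply]
        linear_combination (expWeight κ n : ℂ) * h1
      rw [pencilL2_apply, latticePencil]
      apply h2
      rw [latticeLaplacian, Finset.mul_sum, ← Finset.sum_sub_distrib]
      refine Finset.sum_congr rfl fun i _ => ?_
      simp only [hχ, damped_apply]
      push_cast
      ring
    have hr : (((Real.exp κ - 1 : ℝ) : ℂ) • laplacianL2 ν : L2 d) n
        = (((Real.exp κ - 1) * ∑ i : Fin d, (‖χ (n + Pi.single i 1)‖ + ‖χ (n - Pi.single i 1)‖)
          : ℝ) : ℂ) := by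
      rw [lp.coeFn_smul, Pi.smul_apply, laplacianL2_apply, smul_eq_mul, latticeLaplacian]
      simp [ν]
    rw [hr, Complex.norm_real, Real.norm_of_nonneg (mul_nonneg hη
      (Finset.sum_nonneg fun i _ => add_nonneg (norm_nonneg _) (norm_nonneg _))), hcomm,
      Finset.mul_sum]
    refine norm_sum_le_of_le _ fun i _ => (norm_add_le _ _).trans ?_
    rw [mul_add]
    exact add_le_add (hstep _ (hnb1 i)) (hstep _ (hnb2 i))
  refine (lp.norm_mono (by norm_num) hpt).trans ?_
  rw [norm_smul, Complex.norm_real, Real.norm_of_nonneg hη]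
  refine mul_le_mul_of_nonneg_left ((norm_laplacianL2_le ν).trans ?_) hη
  exact mul_le_mul_of_nonneg_left hν (by positivity)

/-- Changing the potential has little effect on damped functions if the change is small on bounded
sets, uniformly over all bounded functions that are damped. -/
theorem tendsto_norm_resolventMul_sub {d : ℕ} {κ : ℝ} (hκ : 0 < κ)
    (φ : ℕ → (Fin d → ℤ) → ℂ) (hφ : ∀ k n, ‖φ k n‖ ≤ 1) (V W : ℕ → (Fin d → ℤ) → OnePoint ℝ)
    (h : ∀ n, Tendsto (fun k => ‖resolventValue (V k n) - resolventValue (W k n)‖) atTop (𝓝 0)) :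
    Tendsto (fun k => ‖resolventMul (V k) (damped hκ (φ k) (hφ k))
      - resolventMul (W k) (damped hκ (φ k) (hφ k))‖) atTop (𝓝 0) := by
  have hle : ∀ k n, ‖(resolventMul (V k) (damped hκ (φ k) (hφ k))
      - resolventMul (W k) (damped hκ (φ k) (hφ k)) : L2 d) n‖
      ≤ ‖resolventValue (V k n) - resolventValue (W k n)‖ * expWeight κ n := by
    intro k n
    have : (resolventMul (V k) (damped hκ (φ k) (hφ k))
        - resolventMul (W k) (damped hκ (φ k) (hφ k)) : L2 d) n
        = (resolventValue (V k n) - resolventValue (W k n)) * damped hκ (φ k) (hφ k) n := by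
      rw [lp.coeFn_sub, Pi.sub_apply, resolventMul_apply, resolventMul_apply, sub_mul]
    rw [this, norm_mul]
    exact mul_le_mul_of_nonneg_left (norm_damped_apply_le hκ _ _ n) (norm_nonneg _)
  have hsq : Tendsto (fun k => ∑' n, ‖(resolventMul (V k) (damped hκ (φ k) (hφ k))
      - resolventMul (W k) (damped hκ (φ k) (hφ k)) : L2 d) n‖ ^ 2) atTop
      (𝓝 (∑' _ : Fin d → ℤ, (0 : ℝ))) := by
    refine tendsto_tsum_of_dominated_convergence (bound := fun n => 4 * expWeight κ n ^ 2)
      ((summable_expWeight_sq hκ).mul_left 4) (fun n => ?_) (Eventually.of_forall fun k n => ?_)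
    · have h1 := ((h n).mul_const (expWeight κ n)).pow 2
      rw [zero_mul, zero_pow two_ne_zero] at h1
      exact squeeze_zero (fun k => by positivity) (fun k => by gcongr; exact hle k n) h1
    · rw [norm_pow, norm_norm]
      have h2 : ‖resolventValue (V k n) - resolventValue (W k n)‖ ≤ 2 := by
        refine (norm_sub_le _ _).trans ?_
        linarith [norm_resolventValue_le_one (V k n), norm_resolventValue_le_one (W k n)]
      calc _ ≤ (2 * expWeight κ n) ^ 2 := by
            gcongr
            exact (hle k n).trans (mul_le_mul_of_nonneg_right h2 (expWeight_pos κ n).le)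
        _ = 4 * expWeight κ n ^ 2 := by ring
  rw [tsum_zero] at hsq
  simp only [← norm_sq_eq_tsum] at hsq
  have := (Real.continuous_sqrt.tendsto 0).comp hsq
  simpa [Function.comp_def, Real.sqrt_sq] using this

/-! ### Approximation by rational frequencies -/

theorem circleMap01_coe {f : ℝ → WithBot ℝ} (hf : Function.Periodic f 1) (y : ℝ) :
    circleMap01 f (y : UnitAddCircle) = toRbar (f y) := by
  have h1 : ((Int.fract y : ℝ) : UnitAddCircle) = y := by
    rw [← Int.self_sub_floor, AddCircle.coe_sub, sub_eq_self]
    simp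
  rw [← h1, circleMap01, AddCircle.liftIco_coe_apply (by
    rw [zero_add]
    exact ⟨Int.fract_nonneg y, Int.fract_lt_one y⟩), ← Int.self_sub_floor]
  have := hf.sub_int_mul_eq (x := y) ⌊y⌋
  rw [mul_one] at this
  rw [this]

theorem quasiperiodicPotential_eq {d : ℕ} {f : ℝ → WithBot ℝ} (hf : Function.Periodic f 1)
    (α : Fin d → ℝ) (x : ℝ) (n : Fin d → ℤ) :
    quasiperiodicPotential f α x n
      = circleMap01 f ((x + ∑ i, (n i : ℝ) * α i : ℝ) : UnitAddCircle) :=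
  (circleMap01_coe hf _).symm

/-- Since some component of `α` is irrational, the orbit `x + m · α` is dense in the circle. -/
theorem exists_dist_orbit_lt {d : ℕ} {α : Fin d → ℝ} (hα : ∃ i, Irrational (α i)) (x : ℝ)
    (y : UnitAddCircle) {ε : ℝ} (hε : 0 < ε) :
    ∃ m : Fin d → ℤ, dist y ((x + ∑ i, (m i : ℝ) * α i : ℝ) : UnitAddCircle) < ε := by
  obtain ⟨i, hi⟩ := hα
  have hd : DenseRange (· • (α i : UnitAddCircle) : ℤ → UnitAddCircle) :=
    AddCircle.denseRange_zsmul_coe_iff.2 (by rwa [div_one])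
  obtain ⟨k, hk⟩ := Metric.denseRange_iff.1 hd (y - x) ε hε
  refine ⟨Pi.single i k, ?_⟩
  have h1 : ∑ j, ((Pi.single i k : Fin d → ℤ) j : ℝ) * α j = k * α i := by
    rw [Finset.sum_eq_single i]
    · simp
    · intro j _ hj
      simp [hj]
    · simp
  rw [h1, AddCircle.coe_add]
  rw [dist_eq_norm] at hk ⊢
  have h2 : ((k * α i : ℝ) : UnitAddCircle) = k • (α i : UnitAddCircle) := by
    rw [← AddCircle.coe_zsmul, zsmul_eq_mul]
  rw [h2, ← sub_sub]
  exact hk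

theorem norm_coe_unitAddCircle_le (t : ℝ) : ‖(t : UnitAddCircle)‖ ≤ |t| :=
  QuotientAddGroup.norm_mk_le_norm

/-- Every real number is in the spectrum: generalized eigenfunctions of rational approximants,
damped and translated, contradict the lower bound that holds on the resolvent set. -/
theorem ofReal_notMem_unboundedResolventSet {d : ℕ} {α : Fin d → ℝ} (hα : ∃ i, Irrational (α i))
    {f : ℝ → WithBot ℝ} (hf : Function.Periodic f 1) (F : C(UnitAddCircle, OnePoint ℝ))
    (hFf : ∀ y, F y = circleMap01 f y) (hF : ¬ F.Nullhomotopic) (x E : ℝ) :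
    (E : ℂ) ∉ unboundedResolventSet (quasiperiodicOperator f α x) := by
  rintro ⟨-, C, hC⟩
  set V := quasiperiodicPotential f α x with hV
  have hC' : ∀ ψ : (schrodinger V).domain,
      ‖(ψ : L2 d)‖ ≤ |C| * ‖schrodinger V ψ - (E : ℂ) • (ψ : L2 d)‖ := fun ψ =>
    (hC ψ).trans (mul_le_mul_of_nonneg_right (le_abs_self C) (norm_nonneg _))
  set B : ℝ := 2 * d + ‖(E : ℂ) + I‖ with hB
  set K : ℝ := 1 + B * |C| with hK
  have hB0 : 0 ≤ B := by positivity
  have hK0 : 0 < K := by positivity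
  have hlower : ∀ (m : Fin d → ℤ) (χ : L2 d), ‖χ‖ ≤ K * ‖pencilL2 (fun n => V (n + m)) E χ‖ := by
    intro m χ
    rw [← norm_pencilL2_translate, ← LinearIsometry.norm_map (shift (-m)) χ]
    exact norm_le_of_resolvent_bound (abs_nonneg C) hC' _
  -- the damping rate for which the error of `norm_pencilL2_damped_le` is absorbed
  set η : ℝ := 1 / (4 * d * K + 1) with hη
  have hη0 : 0 < η := by positivity
  set κ : ℝ := Real.log (1 + η) with hκ
  have hκ0 : 0 < κ := Real.log_pos (by linarith)
  have hexp : Real.exp κ - 1 = η := by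
    rw [hκ, Real.exp_log (by linarith)]
    ring
  have hsmall : K * (η * (2 * d)) ≤ 1 / 2 := by
    rw [hη]
    field_simp
    linarith
  let p : ℕ → Fin d → ℤ := fun k i => round (((k + 1 : ℕ) : ℝ) * α i)
  have hp : ∀ k i, |(p k i : ℝ) / ((k + 1 : ℕ) : ℝ) - α i| ≤ 1 / (k + 1) := by
    intro k i
    have h1 : (0 : ℝ) < (k : ℝ) + 1 := by positivity
    have h2 := abs_sub_round ((((k + 1 : ℕ) : ℝ)) * α i)
    have h3 : (p k i : ℝ) / ((k + 1 : ℕ) : ℝ) - α i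
        = -((((k + 1 : ℕ) : ℝ)) * α i - p k i) / (k + 1) := by
      push_cast
      field_simp
      ring
    rw [h3, abs_div, abs_neg, abs_of_pos h1]
    exact div_le_div_of_nonneg_right (h2.trans (by norm_num)) h1.le
  choose y φ hφ0 hφ hsol using fun k : ℕ =>
    exists_bounded_latticePencil_eq_zero (N := k + 1) (p k) F hF E
  choose m hm using fun k : ℕ =>
    exists_dist_orbit_lt hα x (y k) (show (0 : ℝ) < 1 / ((k : ℝ) + 1) by positivity)
  let W : ℕ → (Fin d → ℤ) → OnePoint ℝ := fun k n =>
    F (y k + ((∑ i, (n i : ℝ) * (p k i / (k + 1 : ℕ)) : ℝ) : UnitAddCircle))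
  let V' : ℕ → (Fin d → ℤ) → OnePoint ℝ := fun k n => V (n + m k)
  have hV' : ∀ k n, V' k n = F (((x + ∑ i, (m k i : ℝ) * α i : ℝ) : UnitAddCircle)
      + ((∑ i, (n i : ℝ) * α i : ℝ) : UnitAddCircle)) := by
    intro k n
    simp only [V', hV]
    rw [quasiperiodicPotential_eq hf, hFf, ← AddCircle.coe_add]
    congr 2
    rw [add_assoc, ← Finset.sum_add_distrib]
    congr 1
    refine Finset.sum_congr rfl fun i _ => ?_
    rw [Pi.add_apply]
    push_cast
    ring
  have hclose : ∀ n, Tendsto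
      (fun k => ‖resolventValue (V' k n) - resolventValue (W k n)‖) atTop (𝓝 0) := by
    intro n
    have hu : UniformContinuous fun t : UnitAddCircle => resolventValue (F t) :=
      CompactSpace.uniformContinuous_of_continuous
        (continuous_resolventValue.comp F.continuous)
    rw [Metric.uniformContinuous_iff] at hu
    rw [Metric.tendsto_atTop]
    intro ε hε
    obtain ⟨δ, hδ, hu⟩ := hu ε hε
    have hlim : Tendsto (fun k : ℕ => (1 + ∑ i, |(n i : ℝ)|) * (1 / ((k : ℝ) + 1))) atTop (𝓝 0) := by
      simpa using tendsto_one_div_add_atTop_nhds_zero_nat.const_mul (1 + ∑ i, |(n i : ℝ)|)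
    obtain ⟨k₀, hk₀⟩ := Filter.eventually_atTop.1 (hlim.eventually (gt_mem_nhds hδ))
    refine ⟨k₀, fun k hk => ?_⟩
    rw [dist_zero_right, norm_norm, hV', ← dist_eq_norm, dist_comm]
    refine hu ((?_ : _ ≤ _).trans_lt (hk₀ k hk))
    refine (dist_add_add_le _ _ _ _).trans ?_
    rw [add_mul, one_mul]
    refine add_le_add (hm k).le ?_
    rw [dist_eq_norm, ← AddCircle.coe_sub, ← Finset.sum_sub_distrib]
    refine (norm_coe_unitAddCircle_le _).trans ((Finset.abs_sum_le_sum_abs _ _).trans ?_)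
    rw [Finset.sum_mul]
    refine Finset.sum_le_sum fun i _ => ?_
    rw [← mul_sub, abs_mul]
    exact mul_le_mul_of_nonneg_left (hp k i) (abs_nonneg _)
  have hlim := (tendsto_norm_resolventMul_sub hκ0 φ hφ V' W hclose).const_mul (K * B)
  rw [mul_zero] at hlim
  obtain ⟨k, hk⟩ := (hlim.eventually (gt_mem_nhds (show (0 : ℝ) < 1 / 2 by norm_num))).exists
  set χ := damped hκ0 (φ k) (hφ k) with hχ
  have h1 : 1 ≤ ‖χ‖ := by
    have h := lp.norm_apply_le_norm (by norm_num) χ (0 : Fin d → ℤ)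
    rw [hχ, damped_apply, norm_mul, hφ0] at h
    simpa [expWeight] using h
  have h2 := hlower (m k) χ
  have h3 := norm_pencilL2_le_add (V' k) (W k) E χ
  have h4 := norm_pencilL2_damped_le hκ0 (φ k) (hφ k) (W k) E (hsol k)
  rw [hexp, ← hχ] at h4
  have h5 : ‖χ‖ ≤ K * (η * (2 * d)) * ‖χ‖
      + K * B * ‖resolventMul (V' k) χ - resolventMul (W k) χ‖ := by
    calc ‖χ‖ ≤ K * (η * (2 * d * ‖χ‖) + B * ‖resolventMul (V' k) χ - resolventMul (W k) χ‖) :=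
          h2.trans (mul_le_mul_of_nonneg_left (h3.trans (add_le_add_left h4 _)) hK0.le)
      _ = _ := by ring
  have h6 : K * (η * (2 * d)) * ‖χ‖ ≤ 1 / 2 * ‖χ‖ :=
    mul_le_mul_of_nonneg_right hsmall (norm_nonneg _)
  linarith

end

theorem theorem4p4 (d : ℕ) (α : Fin d → ℝ) (hα : ∃ i, Irrational (α i))
    (f : ℝ → WithBot ℝ) (hf : Function.Periodic f 1)
    (hcont : Continuous (circleMap01 f))
    (hhom : ¬ ContinuousMap.Nullhomotopic
      (⟨circleMap01 f, hcont⟩ : C(UnitAddCircle, OnePoint ℝ)))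
    (x : ℝ) :
    unboundedSpectrum (quasiperiodicOperator f α x) = Set.range ((↑) : ℝ → ℂ) := by
  ext z
  constructor
  · intro hz
    refine ⟨z.re, Complex.ext rfl ?_⟩
    by_contra him
    exact hz (mem_unboundedResolventSet_of_im_ne_zero _ fun h => him (by simp [h]))
  · rintro ⟨E, rfl⟩
    exact ofReal_notMem_unboundedResolventSet hα hf _ (fun _ => rfl) hhom x E
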